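/- Let $d\ge 2$, let $\sigma=\operatorname{conv}\{v_1,\dots,v_d\}$ be a $(d-1)$-simplex in $\mathbb{R}^{d-1}$ and let $c$ be a point in the interior of $\sigma$. If $\mathcal T$ is a triangulation, $F$ one of its full-dimensional simplices and $p$ a point in the interior of $F$, then the *single stellar subdivision* of $\mathcal T$ at $F$ by $p$ is the triangulation obtained from $\mathcal T$ by replacing $F$ by the simplices spanned by $p$ and a (possibly empty) proper face of $F$. A finite triangulation $\mathcal T$ of the convex hull of its vertex set $V$, where $V$ affinely spans $\mathbb{R}^{d-1}$, is a *Delaunay triangulation* if for every $(d-1)$-simplex of $\mathcal T$ there is a sphere that passes through all of its vertices such that all other points of $V$ lie strictly outside this sphere. Let $\Delta$ be the single stellar subdivision by $c$ of the triangulation consisting of $\sigma$ and its faces. Its $(d-1)$-simplices are $F_j=\operatorname{conv}(\{c,v_1,\dots,v_d\}\setminus\{v_j\})$, $1\le j\le d$. Let $F_{j_1},\dots,F_{j_k}$ be $k$ distinct ones among them, and let $r_i$ be a point in the interior of $F_{j_i}$ for $1\le i\le k$. Let $\mathcal T$ be the triangulation that arises from $\Delta$ by the single stellar subdivisions at $F_{j_1},\dots,F_{j_k}$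 by $r_1,\dots,r_k$. If $\mathcal T$ is a Delaunay triangulation, then $k<3$. -/

import Mathlib

open Classical in
/-- The triangulation that has just one full-dimensional simplex `σ`: its faces are the nonempty
subsets of the vertex set of `σ`. -/
noncomputable def simplexComplex {n : ℕ} (σ : Affine.Simplex ℝ (EuclideanSpace ℝ (Fin n)) n) :
    Geometry.SimplicialComplex ℝ (EuclideanSpace ℝ (Fin n)) where
  faces := {s | s.Nonempty ∧ s ⊆ Finset.univ.image σ.points}
  isRelLowerSet_faces := fun _ hs =>
    ⟨hs.1, fun _ hts ht => ⟨ht, hts.trans hs.2⟩⟩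
  indep := fun {s} hs => by
    refine σ.independent.range.mono fun x hx => ?_
    simpa using hs.2 hx
  inter_subset_convexHull := fun {s t} hs ht => by
    refine (AffineIndependent.convexHull_inter (R := ℝ)
      (s := Finset.univ.image σ.points) ?_ hs.2 ht.2).ge
    refine σ.independent.range.mono fun x hx => ?_
    simpa using hx

open Classical in
/-- `T'` is the single stellar subdivision of the triangulation `T` at the full-dimensional
simplex `σ` (given by its vertex set) by the point `p` inside `σ`: the simplex `σ` is replaced by
the simplices spanned by `p` and a (possibly empty) proper face of `σ`. -/
def IsStellarSubdivision {n : ℕ} (T : Geometry.SimplicialComplex ℝ (EuclideanSpace ℝ (Fin n)))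
    (σ : Finset (EuclideanSpace ℝ (Fin n))) (p : EuclideanSpace ℝ (Fin n))
    (T' : Geometry.SimplicialComplex ℝ (EuclideanSpace ℝ (Fin n))) : Prop :=
  σ ∈ T.faces ∧ σ.card = n + 1 ∧
    p ∈ interior (convexHull ℝ (σ : Set (EuclideanSpace ℝ (Fin n)))) ∧
    T'.faces = (T.faces \ {σ}) ∪ {s | ∃ τ, τ ⊂ σ ∧ s = insert p τ}

/-- The face `s` of the triangulation `T` is Delaunay: there is a sphere passing through the
vertices of `s` such that all other vertices of `T` lie (strictly) outside of it. -/
def IsDelaunayFace {n : ℕ} (T : Geometry.SimplicialComplex ℝ (EuclideanSpace ℝ (Fin n)))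
    (s : Finset (EuclideanSpace ℝ (Fin n))) : Prop :=
  ∃ S : EuclideanGeometry.Sphere (EuclideanSpace ℝ (Fin n)),
    (∀ v ∈ s, v ∈ S) ∧ ∀ w ∈ T.vertices, w ∉ s → S.radius < dist w S.center

/-- `T` is a Delaunay triangulation: it is a finite triangulation of the convex hull of its
affinely spanning vertex set, and all full-dimensional faces are Delaunay. -/
structure IsDelaunayTriangulation {n : ℕ}
    (T : Geometry.SimplicialComplex ℝ (EuclideanSpace ℝ (Fin n))) : Prop where
  finite : T.faces.Finite
  spanning : affineSpan ℝ T.vertices = ⊤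
  space_eq : T.space = convexHull ℝ T.vertices
  delaunay : ∀ s ∈ T.faces, s.card = n + 1 → IsDelaunayFace T s

open Classical in
/-- The vertex set `{c, v₁, …, v_d} \ {v_j}` of the `j`-th full-dimensional face of the single
stellar subdivision by `c` of the simplex `σ` with vertices `v₁, …, v_d`. -/
noncomputable def stellarFacet {n : ℕ} (σ : Affine.Simplex ℝ (EuclideanSpace ℝ (Fin n)) n)
    (c : EuclideanSpace ℝ (Fin n)) (j : Fin (n + 1)) : Finset (EuclideanSpace ℝ (Fin n)) :=
  insert c ((Finset.univ.erase j).image σ.points)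

/-! Let `lam` be the barycentric coordinates of `c` in `σ` and `Q = ∑ lam i * ‖v i - c‖ ^ 2`. If `r`
in `F_j` has weight `a₀` at `c` and `a l` at `v l`, let `e` be the moment of these weights about
`r`. Take the sphere through `c`, `r` and all `v m` with `m ≠ j, l`. Averaging powers with the
weights of `r` shows that `v l` has power `e / a l`; averaging with `lam` shows that the powers of
`v j` and `v l`, weighted by `lam`, add up to `Q`.

The Delaunay property makes `v j` lie outside, so `lam l * e / a l ≤ Q`. If `F_l` is subdivided too,
its new point is not inside, so the quantities `X = lam l * e / (a l * Q)` for the ordered pairs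
`(j, l)` and `(l, j)` have sum at most one (`hpower` and the end of `mainTheorem3`).

Scaling the weights of `r` by `Q / e` and dropping the apex gives a moment below `Q`
(`IsFacetCombination.rescaled_moment_lt`). For three facets, the other vertices are merged into one
mass, the three moments are bounded below independently of the `r i`, and the sum contradicts the
moment of `lam` being at least `Q` (`not_three_moments_lt`). -/

/-! ### Moment inequalities for weighted points. -/

section Inequalities

variable {V : Type*} [NormedAddCommGroup V] [InnerProductSpace ℝ V]

/-- The weighted sum of squared distances to a point is the mass times the squared distance to
the centroid, up to a constant. -/
theorem exists_forall_sum_mul_norm_sub_sq {ι : Type*} (s : Finset ι) (w : ι → ℝ) (v : ι → V)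
    (hw : ∀ i ∈ s, 0 < w i) :
    ∃ (m : V) (K : ℝ), ∀ p : V,
      ∑ i ∈ s, w i * ‖v i - p‖ ^ 2 = (∑ i ∈ s, w i) * ‖m - p‖ ^ 2 + K := by
  rcases s.eq_empty_or_nonempty with rfl | hs
  -- In the plane no vertex remains besides the three distinguished ones, so the empty sum does
  -- occur.
  · exact ⟨0, 0, by simp⟩
  have hM : 0 < ∑ i ∈ s, w i := Finset.sum_pos hw hs
  set M := ∑ i ∈ s, w i with hMdef
  refine ⟨M⁻¹ • ∑ i ∈ s, w i • v i,
    ∑ i ∈ s, w i * ‖v i‖ ^ 2 - M * ‖M⁻¹ • ∑ i ∈ s, w i • v i‖ ^ 2, fun p => ?_⟩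
  have h1 : ∑ i ∈ s, w i * ‖v i - p‖ ^ 2 =
      ∑ i ∈ s, w i * ‖v i‖ ^ 2 - 2 * inner ℝ (∑ i ∈ s, w i • v i) p + M * ‖p‖ ^ 2 := by
    rw [sum_inner, Finset.mul_sum, hMdef, Finset.sum_mul, ← Finset.sum_sub_distrib,
      ← Finset.sum_add_distrib]
    refine Finset.sum_congr rfl fun i _ => ?_
    rw [norm_sub_sq_real, real_inner_smul_left]
    ring
  rw [h1, norm_sub_sq_real, real_inner_smul_left]
  field_simp
  ring

/-- For weights of sum one, the weighted mean of the power of the points exceeds the power of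
their centroid by the variance. -/
theorem sum_mul_norm_sub_sq_eq_variance {ι : Type*} (s : Finset ι) (w : ι → ℝ) (v : ι → V)
    (p z : V) (hw : ∑ i ∈ s, w i = 1) (hp : ∑ i ∈ s, w i • v i = p) :
    ∑ i ∈ s, w i * ‖v i - z‖ ^ 2 = ∑ i ∈ s, w i * ‖v i - p‖ ^ 2 + ‖p - z‖ ^ 2 := by
  have key : ∀ y : V, ∑ i ∈ s, w i * ‖v i - y‖ ^ 2 =
      ∑ i ∈ s, w i * ‖v i‖ ^ 2 - 2 * inner ℝ p y + ‖y‖ ^ 2 := by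
    intro y
    have h : ‖y‖ ^ 2 = ∑ i ∈ s, w i * ‖y‖ ^ 2 := by rw [← Finset.sum_mul, hw, one_mul]
    rw [h, ← hp, sum_inner, Finset.mul_sum, ← Finset.sum_sub_distrib, ← Finset.sum_add_distrib]
    refine Finset.sum_congr rfl fun i _ => ?_
    rw [norm_sub_sq_real, real_inner_smul_left]
    ring
  rw [key z, key p, norm_sub_sq_real, real_inner_self_eq_norm_sq]
  ring

/-- The difference of the two sides is `‖M • (m - p) + u • (a - p) + w • (b - p)‖ ^ 2`. This removes
`p` from the moment condition, leaving only mutual distances. -/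
theorem three_point_moment_le (M u w : ℝ) (m a b p : V) :
    u * M * ‖a - m‖ ^ 2 + w * M * ‖b - m‖ ^ 2 + u * w * ‖a - b‖ ^ 2 ≤
      (M + u + w) * (M * ‖m - p‖ ^ 2 + u * ‖a - p‖ ^ 2 + w * ‖b - p‖ ^ 2) := by
  have h : (0 : ℝ) ≤ ‖M • (m - p) + u • (a - p) + w • (b - p)‖ ^ 2 := by positivity
  obtain ⟨A, hA⟩ : ∃ A, A = m - p := ⟨_, rfl⟩
  obtain ⟨B, hB⟩ : ∃ B, B = a - p := ⟨_, rfl⟩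
  obtain ⟨C, hC⟩ : ∃ C, C = b - p := ⟨_, rfl⟩
  have e1 : a - m = B - A := by rw [hA, hB]; abel
  have e2 : b - m = C - A := by rw [hA, hC]; abel
  have e3 : a - b = B - C := by rw [hB, hC]; abel
  rw [← hA, ← hB, ← hC, ← real_inner_self_eq_norm_sq] at h
  rw [e1, e2, e3, ← hA, ← hB, ← hC, norm_sub_sq_real, norm_sub_sq_real, norm_sub_sq_real]
  simp only [inner_add_left, inner_add_right, real_inner_smul_left, real_inner_smul_right,
    real_inner_self_eq_norm_sq, real_inner_comm A B, real_inner_comm A C,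
    real_inner_comm B C] at h
  rw [real_inner_comm A B, real_inner_comm A C]
  simp only [norm_smul, mul_pow, Real.norm_eq_abs, sq_abs] at h
  linarith

/-- The equality case of the same identity: about the centroid, the moment is the sum over pairs of
the product of masses times the squared distance. -/
theorem four_point_moment (l₁ l₂ l₃ M : ℝ) (hsum : l₁ + l₂ + l₃ + M = 1) (a b d m : V) :
    let p := l₁ • a + l₂ • b + l₃ • d + M • m
    l₁ * ‖a - p‖ ^ 2 + l₂ * ‖b - p‖ ^ 2 + l₃ * ‖d - p‖ ^ 2 + M * ‖m - p‖ ^ 2 =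
      l₁ * l₂ * ‖a - b‖ ^ 2 + l₁ * l₃ * ‖a - d‖ ^ 2 + l₂ * l₃ * ‖b - d‖ ^ 2 +
        M * (l₁ * ‖a - m‖ ^ 2 + l₂ * ‖b - m‖ ^ 2 + l₃ * ‖d - m‖ ^ 2) := by
  intro p
  obtain ⟨A, hA⟩ : ∃ A, A = a - m := ⟨_, rfl⟩
  obtain ⟨B, hB⟩ : ∃ B, B = b - m := ⟨_, rfl⟩
  obtain ⟨C, hC⟩ : ∃ C, C = d - m := ⟨_, rfl⟩
  have hp : p = m + (l₁ • A + l₂ • B + l₃ • C) := by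
    have : M = 1 - l₁ - l₂ - l₃ := by linarith
    simp only [p, hA, hB, hC, this]
    module
  obtain ⟨G, hG⟩ : ∃ G, G = l₁ • A + l₂ • B + l₃ • C := ⟨_, rfl⟩
  have e1 : a - p = A - G := by rw [hp, ← hG, hA]; abel
  have e2 : b - p = B - G := by rw [hp, ← hG, hB]; abel
  have e3 : d - p = C - G := by rw [hp, ← hG, hC]; abel
  have e4 : m - p = -G := by rw [hp, ← hG]; abel
  have f1 : a - b = A - B := by rw [hA, hB]; abel
  have f2 : a - d = A - C := by rw [hA, hC]; abel
  have f3 : b - d = B - C := by rw [hB, hC]; abel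
  rw [e1, e2, e3, e4, f1, f2, f3, ← hA, ← hB, ← hC, norm_neg]
  simp only [norm_sub_sq_real]
  have hGG : ‖G‖ ^ 2 = inner ℝ G G := (real_inner_self_eq_norm_sq G).symm
  rw [hGG, hG]
  simp only [inner_add_left, inner_add_right, real_inner_smul_left, real_inner_smul_right,
    real_inner_self_eq_norm_sq, real_inner_comm A B, real_inner_comm A C,
    real_inner_comm B C]
  simp only [norm_smul, mul_pow, Real.norm_eq_abs, sq_abs]
  rw [show M = 1 - l₁ - l₂ - l₃ by linarith]
  ring

/-- The planar core of the obstruction: in terms of reciprocal weights, three facets cannot be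
subdivided at the same time. -/
theorem not_three_pairwise_bounds {l₁ l₂ l₃ M Q x y z f₁ f₂ f₃ D₁₂ D₁₃ D₂₃ : ℝ}
    (hM : 0 ≤ M) (hsum : l₁ + l₂ + l₃ + M = 1)
    (hx : 0 ≤ x) (hx' : x ≤ 1) (hy : 0 ≤ y) (hy' : y ≤ 1) (hz : 0 ≤ z) (hz' : z ≤ 1)
    (hQ : 0 ≤ Q)
    (hle : Q ≤ l₁ * l₂ * D₁₂ + l₁ * l₃ * D₁₃ + l₂ * l₃ * D₂₃ +
      M * (l₁ * f₁ + l₂ * f₂ + l₃ * f₃))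
    (h₁ : l₂ * l₃ * D₂₃ + M * (l₂ * y * f₂ + l₃ * x * f₃) <
      Q * (l₂ * y + l₃ * x + M * (x * y)))
    (h₂ : l₁ * l₃ * D₁₃ + M * (l₁ * z * f₁ + l₃ * (1 - x) * f₃) <
      Q * (l₁ * z + l₃ * (1 - x) + M * ((1 - x) * z)))
    (h₃ : l₁ * l₂ * D₁₂ + M * (l₁ * (1 - z) * f₁ + l₂ * (1 - y) * f₂) <
      Q * (l₁ * (1 - z) + l₂ * (1 - y) + M * ((1 - y) * (1 - z)))) : False := by
  have hS : 0 ≤ y * (1 - x) * (1 - z) + x * z * (1 - y) := by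
    have := sub_nonneg.2 hx'
    have := sub_nonneg.2 hy'
    have := sub_nonneg.2 hz'
    positivity
  have hQMS : 0 ≤ Q * M * (y * (1 - x) * (1 - z) + x * z * (1 - y)) := by positivity
  have hM' : M = 1 - l₁ - l₂ - l₃ := by linarith
  -- Adding `h₁`, `h₂`, `h₃`, the complementary factors `x, 1 - x` etc. cancel, and the left sides
  -- add up to the bound in `hle`.
  have hlt : Q < Q * (l₁ + l₂ + l₃ +
      M * (x * y + (1 - x) * z + (1 - y) * (1 - z))) := by
    nlinarith [h₁, h₂, h₃, hle]
  have heq : Q * (l₁ + l₂ + l₃ + M * (x * y + (1 - x) * z + (1 - y) * (1 - z))) =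
      Q - Q * M * (y * (1 - x) * (1 - z) + x * z * (1 - y)) := by
    rw [hM']; ring
  linarith

/-- The moment condition at one subdivided facet, in terms of reciprocal weights. -/
theorem moment_bound {l₂ l₃ M Q x y : ℝ} (hM : 0 ≤ M) (hl₂ : 0 < l₂) (hl₃ : 0 < l₃)
    (hx : 0 < x) (hy : 0 < y) (a b m p : V)
    (h : M * ‖m - p‖ ^ 2 + l₂ / x * ‖a - p‖ ^ 2 + l₃ / y * ‖b - p‖ ^ 2 < Q) :
    l₂ * l₃ * ‖a - b‖ ^ 2 + M * (l₂ * y * ‖a - m‖ ^ 2 + l₃ * x * ‖b - m‖ ^ 2) <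
      Q * (l₂ * y + l₃ * x + M * (x * y)) := by
  have h1 := three_point_moment_le M (l₂ / x) (l₃ / y) m a b p
  have hN : 0 < M + l₂ / x + l₃ / y := by positivity
  have h2 := h1.trans_lt (mul_lt_mul_of_pos_left h hN)
  have h3 := mul_lt_mul_of_pos_right h2 (mul_pos hx hy)
  have e1 : (l₂ / x * M * ‖a - m‖ ^ 2 + l₃ / y * M * ‖b - m‖ ^ 2 +
      l₂ / x * (l₃ / y) * ‖a - b‖ ^ 2) * (x * y) =
      l₂ * l₃ * ‖a - b‖ ^ 2 + M * (l₂ * y * ‖a - m‖ ^ 2 + l₃ * x * ‖b - m‖ ^ 2) := by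
    field_simp
    ring
  have e2 : (M + l₂ / x + l₃ / y) * Q * (x * y) = Q * (l₂ * y + l₃ * x + M * (x * y)) := by
    field_simp
    ring
  rwa [e1, e2] at h3

/-- Three points `p₁, p₂, p₃` whose weights towards the points `v i` exceed, outside of three
distinguished indices, the barycentric weights of the centroid `c`, and whose mutual weights
have reciprocals of sum at most one, cannot all have smaller moments than `c`. -/
theorem not_three_moments_lt {ι : Type*} [Fintype ι] [DecidableEq ι] (v : ι → V) (l : ι → ℝ)
    (hl : ∀ i, 0 < l i) (hsum : ∑ i, l i = 1) (c : V) (hc : ∑ i, l i • v i = c)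
    {i₁ i₂ i₃ : ι} (h₁₂ : i₁ ≠ i₂) (h₁₃ : i₁ ≠ i₃) (h₂₃ : i₂ ≠ i₃) (p₁ p₂ p₃ : V) {x y z : ℝ}
    (hx : 0 < x) (hx' : x < 1) (hy : 0 < y) (hy' : y < 1) (hz : 0 < z) (hz' : z < 1)
    (h₁ : ∑ i ∈ Finset.univ \ {i₁, i₂, i₃}, l i * ‖v i - p₁‖ ^ 2 +
      l i₂ / x * ‖v i₂ - p₁‖ ^ 2 + l i₃ / y * ‖v i₃ - p₁‖ ^ 2 <
        ∑ i, l i * ‖v i - c‖ ^ 2)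
    (h₂ : ∑ i ∈ Finset.univ \ {i₁, i₂, i₃}, l i * ‖v i - p₂‖ ^ 2 +
      l i₁ / (1 - x) * ‖v i₁ - p₂‖ ^ 2 + l i₃ / z * ‖v i₃ - p₂‖ ^ 2 <
        ∑ i, l i * ‖v i - c‖ ^ 2)
    (h₃ : ∑ i ∈ Finset.univ \ {i₁, i₂, i₃}, l i * ‖v i - p₃‖ ^ 2 +
      l i₁ / (1 - y) * ‖v i₁ - p₃‖ ^ 2 + l i₂ / (1 - z) * ‖v i₂ - p₃‖ ^ 2 <
        ∑ i, l i * ‖v i - c‖ ^ 2) : False := by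
  obtain ⟨m, K, hK⟩ := exists_forall_sum_mul_norm_sub_sq (Finset.univ \ {i₁, i₂, i₃}) l v
    fun i _ => hl i
  have hM : 0 ≤ ∑ i ∈ Finset.univ \ {i₁, i₂, i₃}, l i := Finset.sum_nonneg fun i _ => (hl i).le
  have split : ∀ f : ι → ℝ,
      ∑ i, f i = f i₁ + f i₂ + f i₃ + ∑ i ∈ Finset.univ \ {i₁, i₂, i₃}, f i := by
    intro f
    rw [← Finset.sum_sdiff (Finset.subset_univ {i₁, i₂, i₃}),
      Finset.sum_insert (by simp [h₁₂, h₁₃]), Finset.sum_pair h₂₃]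
    ring
  set M := ∑ i ∈ Finset.univ \ {i₁, i₂, i₃}, l i with hMdef
  have hsum' : l i₁ + l i₂ + l i₃ + M = 1 := by rw [← split, hsum]
  rw [hK] at h₁ h₂ h₃
  set Q := ∑ i, l i * ‖v i - c‖ ^ 2 with hQdef
  have b₁ := moment_bound (Q := Q - K) hM (hl i₂) (hl i₃) hx hy (v i₂) (v i₃) m p₁ (by linarith)
  have b₂ := moment_bound (Q := Q - K) hM (hl i₁) (hl i₃) (sub_pos.2 hx') hz (v i₁) (v i₃) m p₂
    (by linarith)
  have b₃ := moment_bound (Q := Q - K) hM (hl i₁) (hl i₂) (sub_pos.2 hy') (sub_pos.2 hz')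
    (v i₁) (v i₂) m p₃ (by linarith)
  have hQ : 0 ≤ Q - K := by
    have := hl i₂
    have := hl i₃
    have : 0 ≤ M * ‖m - p₁‖ ^ 2 + l i₂ / x * ‖v i₂ - p₁‖ ^ 2 + l i₃ / y * ‖v i₃ - p₁‖ ^ 2 := by
      positivity
    linarith
  have hle := four_point_moment (l i₁) (l i₂) (l i₃) M hsum' (v i₁) (v i₂) (v i₃) m
  simp only at hle
  set p := l i₁ • v i₁ + l i₂ • v i₂ + l i₃ • v i₃ + M • m
  -- The moment of `l` is least at its centroid `c`, so `p` need not be identified with `c`.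
  have hQp : Q ≤ ∑ i, l i * ‖v i - p‖ ^ 2 := by
    rw [sum_mul_norm_sub_sq_eq_variance Finset.univ l v c p hsum hc]
    have : 0 ≤ ‖c - p‖ ^ 2 := by positivity
    linarith
  rw [split, hK] at hQp
  refine not_three_pairwise_bounds hM hsum' hx.le hx'.le hy.le hy'.le hz.le hz'.le hQ
    (by rw [← hle]; linarith) b₁ b₂ b₃

end Inequalities

/-! ### Powers of points and the weights of the subdividing points. -/

section Weights

variable {V : Type*} [NormedAddCommGroup V] [InnerProductSpace ℝ V] {ι : Type*} [Fintype ι]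

/-- `r` is the combination of the apex `c` with weight `a₀` and the points `v l`, `l ≠ j`, with
weights `a l`, all of these weights being positive. -/
structure IsFacetCombination (v : ι → V) (c : V) (j : ι) (r : V) (a₀ : ℝ) (a : ι → ℝ) :
    Prop where
  apex_pos : 0 < a₀
  pos : ∀ l, l ≠ j → 0 < a l
  zero : a j = 0
  sum_eq : a₀ + ∑ l, a l = 1
  comb_eq : a₀ • c + ∑ l, a l • v l = r

/-- The moment about `r` of the weights `a` at the points `v` and `a₀` at the apex `c`. -/
def facetMoment (v : ι → V) (c r : V) (a₀ : ℝ) (a : ι → ℝ) : ℝ :=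
  a₀ * ‖c - r‖ ^ 2 + ∑ l, a l * ‖v l - r‖ ^ 2

variable {v : ι → V} {c : V}

theorem IsFacetCombination.nonneg {j : ι} {r : V} {a₀ : ℝ} {a : ι → ℝ}
    (h : IsFacetCombination v c j r a₀ a) (l : ι) : 0 ≤ a l := by
  by_cases hl : l = j
  · rw [hl, h.zero]
  · exact (h.pos l hl).le

/-- The power of `r` with respect to a sphere, in terms of those of the vertices. -/
theorem IsFacetCombination.power_eq {j : ι} {r : V} {a₀ : ℝ} {a : ι → ℝ}
    (h : IsFacetCombination v c j r a₀ a) (z : V) (R : ℝ) :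
    a₀ * (‖c - z‖ ^ 2 - R) + ∑ l, a l * (‖v l - z‖ ^ 2 - R) =
      facetMoment v c r a₀ a + (‖r - z‖ ^ 2 - R) := by
  have := sum_mul_norm_sub_sq_eq_variance (Finset.univ : Finset (Option ι))
    (fun o => o.elim a₀ a) (fun o => o.elim c v) r z (by simpa using h.sum_eq)
    (by simpa using h.comb_eq)
  simp only [Fintype.sum_option, Option.elim] at this
  have hR : a₀ * R + ∑ l, a l * R = R := by
    rw [← Finset.sum_mul, ← add_mul, h.sum_eq, one_mul]
  simp only [mul_sub, Finset.sum_sub_distrib]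
  unfold facetMoment
  linarith

/-- The sphere through `c`, `r` and all `v m`, `m ≠ j, l`. -/
theorem IsFacetCombination.power_vertex {j l : ι} {r : V} {a₀ : ℝ} {a : ι → ℝ}
    (h : IsFacetCombination v c j r a₀ a) {z : V} {R : ℝ} (hc : ‖c - z‖ ^ 2 - R = 0)
    (hr : ‖r - z‖ ^ 2 - R = 0) (hv : ∀ m, m ≠ j → m ≠ l → ‖v m - z‖ ^ 2 - R = 0) :
    a l * (‖v l - z‖ ^ 2 - R) = facetMoment v c r a₀ a := by
  have h1 := h.power_eq z R
  rw [hc, hr, mul_zero, zero_add, add_zero, Finset.sum_eq_single l] at h1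
  · exact h1
  · intro m _ hm
    by_cases hj : m = j
    · rw [hj, h.zero, zero_mul]
    · rw [hv m hj hm, mul_zero]
  · simp

variable {lam : ι → ℝ}

/-- As `c` has power zero, the `lam`-mean of the powers of the vertices is just the variance; all
but two of its terms vanish. -/
theorem power_pair_eq (hsum : ∑ i, lam i = 1) (hcomb : ∑ i, lam i • v i = c) {j l : ι}
    (hjl : j ≠ l) {z : V} {R : ℝ} (hc : ‖c - z‖ ^ 2 - R = 0)
    (hv : ∀ m, m ≠ j → m ≠ l → ‖v m - z‖ ^ 2 - R = 0) :
    lam j * (‖v j - z‖ ^ 2 - R) + lam l * (‖v l - z‖ ^ 2 - R) =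
      ∑ i, lam i * ‖v i - c‖ ^ 2 := by
  have h1 := sum_mul_norm_sub_sq_eq_variance Finset.univ lam v c z hsum hcomb
  have h2 : ∑ i, lam i * (‖v i - z‖ ^ 2 - R) = ∑ i, lam i * ‖v i - c‖ ^ 2 := by
    simp only [mul_sub, Finset.sum_sub_distrib]
    rw [← Finset.sum_mul, hsum, h1]
    linarith
  rw [← h2, Fintype.sum_eq_add j l hjl]
  intro m hm
  rw [hv m hm.1 hm.2, mul_zero]

/-- Rescaling the weights of an interior point of a facet. -/
theorem IsFacetCombination.rescaled_moment_lt [DecidableEq ι] {j k l : ι} {r : V} {a₀ : ℝ}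
    {a : ι → ℝ} (h : IsFacetCombination v c j r a₀ a) {s : Finset ι} {Q x y : ℝ} (hr : c ≠ r)
    (hQ : 0 < Q) (hkl : k ≠ l) (hk : k ∉ s) (hl : l ∉ s)
    (hs : ∀ m ∈ s, lam m * facetMoment v c r a₀ a ≤ Q * a m)
    (hx : 0 < x) (hy : 0 < y)
    (hxk : lam k * facetMoment v c r a₀ a ≤ Q * a k * x)
    (hyl : lam l * facetMoment v c r a₀ a ≤ Q * a l * y) :
    ∑ m ∈ s, lam m * ‖v m - r‖ ^ 2 + lam k / x * ‖v k - r‖ ^ 2 + lam l / y * ‖v l - r‖ ^ 2 <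
      Q := by
  set e := facetMoment v c r a₀ a with he
  have h0 : 0 < a₀ * ‖c - r‖ ^ 2 := by
    have := h.apex_pos
    have : 0 < ‖c - r‖ := norm_pos_iff.2 (sub_ne_zero.2 hr)
    positivity
  -- Strictness of the conclusion comes from the dropped apex term.
  have hlt : ∑ m, a m * ‖v m - r‖ ^ 2 < e := by
    rw [he]
    unfold facetMoment
    linarith
  have hepos : 0 < e := by
    refine lt_of_le_of_lt (Finset.sum_nonneg fun m _ => ?_) hlt
    have := h.nonneg m
    positivity
  have hsub : ∑ m ∈ s, a m * ‖v m - r‖ ^ 2 + a k * ‖v k - r‖ ^ 2 + a l * ‖v l - r‖ ^ 2 ≤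
      ∑ m, a m * ‖v m - r‖ ^ 2 := by
    have hle := Finset.sum_le_sum_of_subset_of_nonneg (Finset.subset_univ (insert k (insert l s)))
      (f := fun m => a m * ‖v m - r‖ ^ 2)
      fun m _ _ => mul_nonneg (h.nonneg m) (by positivity)
    rw [Finset.sum_insert (by simp [hkl, hk]), Finset.sum_insert hl] at hle
    linarith
  have h1 : e * ∑ m ∈ s, lam m * ‖v m - r‖ ^ 2 ≤ Q * ∑ m ∈ s, a m * ‖v m - r‖ ^ 2 := by
    rw [Finset.mul_sum, Finset.mul_sum]
    refine Finset.sum_le_sum fun m hm => ?_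
    nlinarith [mul_le_mul_of_nonneg_right (hs m hm) (sq_nonneg ‖v m - r‖)]
  have h2 : e * (lam k / x * ‖v k - r‖ ^ 2) ≤ Q * (a k * ‖v k - r‖ ^ 2) := by
    have : lam k * e / x ≤ Q * a k := (div_le_iff₀ hx).2 hxk
    calc _ = lam k * e / x * ‖v k - r‖ ^ 2 := by ring
      _ ≤ Q * a k * ‖v k - r‖ ^ 2 := by gcongr
      _ = _ := by ring
  have h3 : e * (lam l / y * ‖v l - r‖ ^ 2) ≤ Q * (a l * ‖v l - r‖ ^ 2) := by
    have : lam l * e / y ≤ Q * a l := (div_le_iff₀ hy).2 hyl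
    calc _ = lam l * e / y * ‖v l - r‖ ^ 2 := by ring
      _ ≤ Q * a l * ‖v l - r‖ ^ 2 := by gcongr
      _ = _ := by ring
  have h4 := mul_le_mul_of_nonneg_left hsub hQ.le
  have h5 := mul_lt_mul_of_pos_left hlt hQ
  refine lt_of_mul_lt_mul_left (a := e) ?_ hepos.le
  linarith

theorem IsFacetCombination.facetMoment_pos {j : ι} {r : V} {a₀ : ℝ} {a : ι → ℝ}
    (h : IsFacetCombination v c j r a₀ a) (hr : c ≠ r) : 0 < facetMoment v c r a₀ a := by
  have h0 : 0 < a₀ * ‖c - r‖ ^ 2 := by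
    have := h.apex_pos
    have : 0 < ‖c - r‖ := norm_pos_iff.2 (sub_ne_zero.2 hr)
    positivity
  refine add_pos_of_pos_of_nonneg h0 (Finset.sum_nonneg fun m _ => ?_)
  have := h.nonneg m
  positivity

/-- The local Delaunay conditions around `c` cannot hold for three subdivided facets. -/
theorem not_three_facetCombinations (hlam : ∀ i, 0 < lam i)
    (hsum : ∑ i, lam i = 1) (hcomb : ∑ i, lam i • v i = c) (j : Fin 3 → ι)
    (hj : Function.Injective j) (r : Fin 3 → V) (hr : ∀ i, c ≠ r i) (a₀ : Fin 3 → ℝ)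
    (a : Fin 3 → ι → ℝ) (ha : ∀ i, IsFacetCombination v c (j i) (r i) (a₀ i) (a i))
    (h₁ : ∀ i l, l ≠ j i →
      lam l * facetMoment v c (r i) (a₀ i) (a i) ≤ (∑ m, lam m * ‖v m - c‖ ^ 2) * a i l)
    (h₂ : ∀ i i', i ≠ i' →
      lam (j i') * facetMoment v c (r i) (a₀ i) (a i) / a i (j i') +
        lam (j i) * facetMoment v c (r i') (a₀ i') (a i') / a i' (j i) ≤
          ∑ m, lam m * ‖v m - c‖ ^ 2) : False := by
  classical
  set Q := ∑ m, lam m * ‖v m - c‖ ^ 2 with hQdef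
  have he : ∀ i, 0 < facetMoment v c (r i) (a₀ i) (a i) := fun i => (ha i).facetMoment_pos (hr i)
  have hpos : ∀ i i', i ≠ i' → 0 < a i (j i') := fun i i' h =>
    (ha i).pos _ fun hh => h (hj hh).symm
  have hq : ∀ i i', i ≠ i' →
      0 < lam (j i') * facetMoment v c (r i) (a₀ i) (a i) / a i (j i') := fun i i' h =>
    div_pos (mul_pos (hlam _) (he i)) (hpos i i' h)
  have hQ : 0 < Q := by
    have := h₂ 0 1 (by decide)
    have := hq 0 1 (by decide)
    have := hq 1 0 (by decide)
    linarith
  obtain ⟨X, hX⟩ : ∃ X : Fin 3 → Fin 3 → ℝ, ∀ i i',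
      X i i' = lam (j i') * facetMoment v c (r i) (a₀ i) (a i) / a i (j i') / Q :=
    ⟨_, fun _ _ => rfl⟩
  have hX0 : ∀ i i', i ≠ i' → 0 < X i i' := fun i i' h => by
    rw [hX]
    exact div_pos (hq i i' h) hQ
  -- Enlarging a reciprocal weight keeps the moment bound, so `X i' i` may be replaced by `1 - X i
  -- i'`; three parameters `x, y, z` then remain.
  have hX1 : ∀ i i', i ≠ i' → X i i' ≤ 1 - X i' i := fun i i' h => by
    rw [le_sub_iff_add_le, hX, hX, ← add_div, div_le_one hQ]
    exact h₂ i i' h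
  have hXle : ∀ i i' t, i ≠ i' → X i i' ≤ t →
      lam (j i') * facetMoment v c (r i) (a₀ i) (a i) ≤ Q * a i (j i') * t := by
    intro i i' t h ht
    rw [hX, div_div, div_le_iff₀ (mul_pos (hpos i i' h) hQ)] at ht
    linarith
  have key : ∀ i k l, i ≠ k → i ≠ l → k ≠ l → ∀ x y, X i k ≤ x → X i l ≤ y →
      ∑ m ∈ Finset.univ \ {j 0, j 1, j 2}, lam m * ‖v m - r i‖ ^ 2 +
        lam (j k) / x * ‖v (j k) - r i‖ ^ 2 + lam (j l) / y * ‖v (j l) - r i‖ ^ 2 < Q := by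
    intro i k l hik hil hkl x y hx hy
    have hmem : ∀ t, j t ∉ Finset.univ \ {j 0, j 1, j 2} := by
      intro t
      fin_cases t <;> simp
    exact (ha i).rescaled_moment_lt (hr i) hQ (hj.ne hkl) (hmem k) (hmem l)
      (fun m hm => h₁ i m fun hmi => hmem i (hmi ▸ hm))
      ((hX0 i k hik).trans_le hx) ((hX0 i l hil).trans_le hy)
      (hXle i k x hik hx) (hXle i l y hil hy)
  have hlt : ∀ i i', i ≠ i' → X i i' < 1 := fun i i' h => by
    linarith [hX1 i i' h, hX0 i' i h.symm]
  have h01 : (0 : Fin 3) ≠ 1 := by decide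
  have h02 : (0 : Fin 3) ≠ 2 := by decide
  have h12 : (1 : Fin 3) ≠ 2 := by decide
  exact not_three_moments_lt v lam hlam hsum c hcomb (hj.ne h01) (hj.ne h02) (hj.ne h12)
    (r 0) (r 1) (r 2) (hX0 0 1 h01) (hlt 0 1 h01) (hX0 0 2 h02) (hlt 0 2 h02)
    (hX0 1 2 h12) (hlt 1 2 h12)
    (key 0 1 2 h01 h02 h12 _ _ le_rfl le_rfl)
    (key 1 0 2 h01.symm h12 h02 _ _ (hX1 1 0 h01.symm) le_rfl)
    (key 2 0 1 h02.symm h12.symm h01 _ _ (hX1 2 0 h02.symm) (hX1 2 1 h12.symm))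

end Weights

/-! ### Positivity and uniqueness of barycentric coordinates. -/

/-- An interior point of a full-dimensional simplex has positive barycentric coordinates. -/
theorem exists_pos_weights_of_mem_interior_convexHull {E : Type*} [NormedAddCommGroup E]
    [NormedSpace ℝ E] {s : Finset E} (hs : AffineIndependent ℝ ((↑) : s → E)) {p : E}
    (hp : p ∈ interior (convexHull ℝ (s : Set E))) :
    ∃ w : E → ℝ, (∀ x ∈ s, 0 < w x) ∧ ∑ x ∈ s, w x = 1 ∧ ∑ x ∈ s, w x • x = p := by
  classical
  have hspan : affineSpan ℝ (s : Set E) = ⊤ := by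
    rw [← affineSpan_convexHull]
    exact affineSpan_eq_top_of_nonempty_interior
      ((Set.nonempty_of_mem hp).mono (interior_mono (subset_convexHull ℝ _)))
  let b : AffineBasis s ℝ E := ⟨(↑), hs, by simpa using hspan⟩
  have hb : ∀ i, b i = i := fun _ => rfl
  have hrange : Set.range b = (s : Set E) := Subtype.range_coe
  rw [← hrange, b.interior_convexHull] at hp
  refine ⟨fun x => if h : x ∈ s then b.coord ⟨x, h⟩ p else 0, fun x hx => ?_, ?_, ?_⟩
  · simpa [hx] using hp ⟨x, hx⟩
  · rw [← Finset.sum_coe_sort, ← b.sum_coord_apply_eq_one p]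
    exact Finset.sum_congr rfl fun i _ => by simp
  · rw [← Finset.sum_coe_sort]
    conv_rhs => rw [← b.linear_combination_coord_eq_self p]
    exact Finset.sum_congr rfl fun i _ => by simp [hb]

theorem AffineIndependent.weights_eq {E ι : Type*} [AddCommGroup E] [Module ℝ E] [Fintype ι]
    {v : ι → E} (hv : AffineIndependent ℝ v) {x y : ι → ℝ} (hsum : ∑ i, x i = ∑ i, y i)
    (hcomb : ∑ i, x i • v i = ∑ i, y i • v i) : x = y := by
  funext i
  have := (affineIndependent_iff.1 hv) Finset.univ (fun i => x i - y i)
    (by rw [Finset.sum_sub_distrib, hsum, sub_self])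
    (by simp only [sub_smul, Finset.sum_sub_distrib, hcomb, sub_self]) i (Finset.mem_univ i)
  exact sub_eq_zero.1 this

theorem AffineIndependent.ne_of_pos_weights {E ι : Type*} [AddCommGroup E] [Module ℝ E]
    [Fintype ι] [Nontrivial ι] {v : ι → E} (hv : AffineIndependent ℝ v) {x : ι → ℝ}
    (hpos : ∀ i, 0 < x i) (hsum : ∑ i, x i = 1) {p : E} (hcomb : ∑ i, x i • v i = p) (m : ι) :
    p ≠ v m := by
  classical
  intro h
  have := hv.weights_eq (x := x) (y := Pi.single m 1) (by simp [hsum])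
    (by simp [hcomb, h, Pi.single_apply, ite_smul])
  obtain ⟨l, hl⟩ := exists_ne m
  have h2 := hpos l
  rw [this, Pi.single_eq_of_ne hl] at h2
  exact lt_irrefl _ h2

/-! ### Faces of the subdivided triangulation. -/

section Facets

variable {n : ℕ} {σ : Affine.Simplex ℝ (EuclideanSpace ℝ (Fin n)) n}
  {c : EuclideanSpace ℝ (Fin n)}

theorem mem_stellarFacet {x : EuclideanSpace ℝ (Fin n)} {j : Fin (n + 1)} :
    x ∈ stellarFacet σ c j ↔ x = c ∨ ∃ m, m ≠ j ∧ σ.points m = x := by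
  simp [stellarFacet]

theorem exists_isFacetCombination (hc : ∀ m, c ≠ σ.points m) {j : Fin (n + 1)}
    {r : EuclideanSpace ℝ (Fin n)}
    (hF : AffineIndependent ℝ ((↑) : stellarFacet σ c j → EuclideanSpace ℝ (Fin n)))
    (hr : r ∈ interior (convexHull ℝ (stellarFacet σ c j : Set (EuclideanSpace ℝ (Fin n))))) :
    ∃ a₀ a, IsFacetCombination σ.points c j r a₀ a := by
  classical
  obtain ⟨w, hpos, hsum, hcomb⟩ := exists_pos_weights_of_mem_interior_convexHull hF hr
  have hcn : c ∉ (Finset.univ.erase j).image σ.points := by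
    simpa using fun m _ h => hc m h.symm
  have hF' : stellarFacet σ c j = insert c ((Finset.univ.erase j).image σ.points) := by
    unfold stellarFacet
    congr!
  rw [hF', Finset.sum_insert hcn, Finset.sum_image σ.independent.injective.injOn] at hsum hcomb
  refine ⟨w c, fun l => if l = j then 0 else w (σ.points l), hpos c (by simp [hF']), ?_, by simp,
    ?_, ?_⟩
  · intro l hl
    simp only [hl, if_false]
    exact hpos _ (mem_stellarFacet.2 (Or.inr ⟨l, hl, rfl⟩))
  · rw [← hsum, ← Finset.sum_erase Finset.univ (a := j) (by simp)]
    congr 1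
    exact Finset.sum_congr rfl fun l hl => by simp [Finset.ne_of_mem_erase hl]
  · rw [← hcomb, ← Finset.sum_erase Finset.univ (a := j) (by simp)]
    congr 1
    exact Finset.sum_congr rfl fun l hl => by simp [Finset.ne_of_mem_erase hl]

/-- The barycentric coordinates with respect to `σ` of an interior point of a facet of the
stellar subdivision. -/
theorem IsFacetCombination.comb_points {ι V : Type*} [Fintype ι] [NormedAddCommGroup V]
    [InnerProductSpace ℝ V] {v : ι → V} {c r : V} {lam a : ι → ℝ} {a₀ : ℝ} {j : ι}
    (h : IsFacetCombination v c j r a₀ a) (hsum : ∑ i, lam i = 1)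
    (hcomb : ∑ i, lam i • v i = c) :
    ∑ i, (a₀ * lam i + a i) = 1 ∧ ∑ i, (a₀ * lam i + a i) • v i = r := by
  constructor
  · rw [Finset.sum_add_distrib, ← Finset.mul_sum, hsum, mul_one, h.sum_eq]
  · simp only [add_smul, mul_smul, Finset.sum_add_distrib]
    rw [← Finset.smul_sum, hcomb, h.comb_eq]

theorem IsFacetCombination.ne_point {ι V : Type*} [Fintype ι] [Nontrivial ι]
    [NormedAddCommGroup V] [InnerProductSpace ℝ V] {v : ι → V} {c r : V} {lam a : ι → ℝ} {a₀ : ℝ}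
    {j : ι} (h : IsFacetCombination v c j r a₀ a) (hv : AffineIndependent ℝ v)
    (hlam : ∀ i, 0 < lam i) (hsum : ∑ i, lam i = 1) (hcomb : ∑ i, lam i • v i = c) (m : ι) :
    r ≠ v m :=
  hv.ne_of_pos_weights
    (fun i => add_pos_of_pos_of_nonneg (mul_pos h.apex_pos (hlam i)) (h.nonneg i))
    (h.comb_points hsum hcomb).1 (h.comb_points hsum hcomb).2 m

/-- If `r = c`, comparing coordinates at `j`, where `a j = 0`, forces `a₀ = 1`, leaving no weight
for the other vertices. -/
theorem IsFacetCombination.ne_apex {ι V : Type*} [Fintype ι] [Nontrivial ι]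
    [NormedAddCommGroup V] [InnerProductSpace ℝ V] {v : ι → V} {c r : V} {lam a : ι → ℝ} {a₀ : ℝ}
    {j : ι} (h : IsFacetCombination v c j r a₀ a) (hv : AffineIndependent ℝ v)
    (hlam : ∀ i, 0 < lam i) (hsum : ∑ i, lam i = 1) (hcomb : ∑ i, lam i • v i = c) :
    c ≠ r := by
  intro hcr
  have hw := hv.weights_eq (x := fun i => a₀ * lam i + a i) (y := lam)
    ((h.comb_points hsum hcomb).1.trans hsum.symm)
    ((h.comb_points hsum hcomb).2.trans (hcr.symm.trans hcomb.symm))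
  have hj := congrFun hw j
  simp only [h.zero, add_zero] at hj
  have h1 : a₀ = 1 := mul_right_cancel₀ (hlam j).ne' (hj.trans (one_mul _).symm)
  obtain ⟨l, hl⟩ := exists_ne j
  have h2 := congrFun hw l
  have h3 := h.pos l hl
  simp only [h1, one_mul] at h2
  linarith

open Classical in
/-- The simplex spanned by `r` and the facet of `stellarFacet σ c j` opposite to the `l`-th
vertex of `σ`. -/
noncomputable def stackedFacet (σ : Affine.Simplex ℝ (EuclideanSpace ℝ (Fin n)) n)
    (c : EuclideanSpace ℝ (Fin n)) (j l : Fin (n + 1)) (r : EuclideanSpace ℝ (Fin n)) :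
    Finset (EuclideanSpace ℝ (Fin n)) :=
  insert r ((stellarFacet σ c j).erase (σ.points l))

theorem self_mem_stackedFacet {j l : Fin (n + 1)} {r : EuclideanSpace ℝ (Fin n)} :
    r ∈ stackedFacet σ c j l r := by
  simp [stackedFacet]

theorem apex_mem_stackedFacet (hc : ∀ m, c ≠ σ.points m) {j l : Fin (n + 1)}
    {r : EuclideanSpace ℝ (Fin n)} : c ∈ stackedFacet σ c j l r := by
  simp [stackedFacet, mem_stellarFacet, hc]

theorem point_mem_stackedFacet {j l m : Fin (n + 1)} {r : EuclideanSpace ℝ (Fin n)}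
    (hj : m ≠ j) (hl : m ≠ l) : σ.points m ∈ stackedFacet σ c j l r := by
  simp only [stackedFacet, Finset.mem_insert, Finset.mem_erase, mem_stellarFacet]
  exact Or.inr ⟨σ.independent.injective.ne hl, Or.inr ⟨m, hj, rfl⟩⟩

theorem point_notMem_stackedFacet (hc : ∀ m, c ≠ σ.points m) {j l : Fin (n + 1)}
    {r : EuclideanSpace ℝ (Fin n)} (hr : ∀ m, r ≠ σ.points m) :
    σ.points j ∉ stackedFacet σ c j l r := by
  simp only [stackedFacet, Finset.mem_insert, Finset.mem_erase, mem_stellarFacet]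
  rintro (h | ⟨_, h | ⟨m, hm, h⟩⟩)
  · exact hr j h.symm
  · exact hc j h.symm
  · exact hm (σ.independent.injective h)

theorem card_stackedFacet {j l : Fin (n + 1)} {r : EuclideanSpace ℝ (Fin n)}
    (hcard : (stellarFacet σ c j).card = n + 1) (hl : l ≠ j) (hr : r ∉ stellarFacet σ c j) :
    (stackedFacet σ c j l r).card = n + 1 := by
  classical
  have hmem : σ.points l ∈ stellarFacet σ c j := mem_stellarFacet.2 (Or.inr ⟨l, hl, rfl⟩)
  unfold stackedFacet
  rw [Finset.card_insert_of_notMem fun h => hr (Finset.mem_of_mem_erase h),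
    Finset.card_erase_of_mem hmem, hcard, Nat.add_sub_cancel]

theorem stackedFacet_mem_faces {j l : Fin (n + 1)} {r : EuclideanSpace ℝ (Fin n)}
    {K K' : Geometry.SimplicialComplex ℝ (EuclideanSpace ℝ (Fin n))}
    (h : IsStellarSubdivision K (stellarFacet σ c j) r K') (hl : l ≠ j) :
    stackedFacet σ c j l r ∈ K'.faces := by
  classical
  rw [h.2.2.2]
  refine Or.inr ⟨_, Finset.erase_ssubset (mem_stellarFacet.2 (Or.inr ⟨l, hl, rfl⟩)), ?_⟩
  unfold stackedFacet
  congr!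

theorem Geometry.SimplicialComplex.mem_vertices_of_mem_face {𝕜 E : Type*} [Ring 𝕜]
    [PartialOrder 𝕜] [AddCommGroup E] [Module 𝕜 E] {K : Geometry.SimplicialComplex 𝕜 E}
    {s : Finset E} {x : E} (hs : s ∈ K.faces) (hx : x ∈ s) : x ∈ K.vertices :=
  K.down_closed hs (Finset.singleton_subset_iff.2 hx) (Finset.singleton_nonempty x)

/-- The sphere of a Delaunay face, by its power function. -/
theorem IsDelaunayFace.exists_power {T : Geometry.SimplicialComplex ℝ (EuclideanSpace ℝ (Fin n))}
    {s : Finset (EuclideanSpace ℝ (Fin n))} (h : IsDelaunayFace T s) (hs : s.Nonempty) :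
    ∃ (z : EuclideanSpace ℝ (Fin n)) (R : ℝ), (∀ x ∈ s, ‖x - z‖ ^ 2 - R = 0) ∧
      ∀ x ∈ T.vertices, x ∉ s → 0 < ‖x - z‖ ^ 2 - R := by
  obtain ⟨S, h1, h2⟩ := h
  have h1' : ∀ x ∈ s, dist x S.center = S.radius := fun x hx => h1 x hx
  refine ⟨S.center, S.radius ^ 2, fun x hx => ?_, fun x hx hxs => ?_⟩
  · rw [← dist_eq_norm, h1' x hx, sub_self]
  · obtain ⟨y, hy⟩ := hs
    have hR : 0 ≤ S.radius := h1' y hy ▸ dist_nonneg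
    rw [← dist_eq_norm, sub_pos]
    exact pow_lt_pow_left₀ (h2 x hx hxs) hR two_ne_zero

/-- Once created, the simplices around an interior point of a facet persist. -/
theorem stackedFacet_mem_last {k : ℕ} {j : Fin k → Fin (n + 1)}
    {r : Fin k → EuclideanSpace ℝ (Fin n)}
    {U : Fin (k + 1) → Geometry.SimplicialComplex ℝ (EuclideanSpace ℝ (Fin n))}
    (hU : ∀ i : Fin k,
      IsStellarSubdivision (U i.castSucc) (stellarFacet σ c (j i)) (r i) (U i.succ))
    (hr : ∀ i m, r i ∉ stellarFacet σ c m) (i : Fin k) {l : Fin (n + 1)} (hl : l ≠ j i) :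
    stackedFacet σ c (j i) l (r i) ∈ (U (Fin.last k)).faces := by
  have key : ∀ m : Fin (k + 1), i.castSucc < m →
      stackedFacet σ c (j i) l (r i) ∈ (U m).faces := by
    intro m
    induction m using Fin.induction with
    | zero => exact fun h => absurd h (Fin.not_lt_zero _)
    | succ m ih =>
      intro h
      rcases eq_or_ne i m with rfl | him
      · exact stackedFacet_mem_faces (hU i) hl
      · have hlt : i.castSucc < m.castSucc := by
          refine lt_of_le_of_ne (Fin.le_castSucc_iff.2 h) fun hh => him ?_
          exact Fin.castSucc_injective _ hh
        rw [(hU m).2.2.2]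
        -- The removed simplex is a facet of `Δ`, which does not contain `r i`.
        exact Or.inl ⟨ih hlt, fun hh => hr i (j m) (hh ▸ self_mem_stackedFacet)⟩
  exact key _ (Fin.castSucc_lt_last i)

end Facets

/-! ### From Delaunay spheres to the weight inequalities. -/

open Classical in
/-- With `d = n + 1`: `σ` is a `(d - 1)`-simplex in `ℝ^(d-1)`, `Δ` its single stellar subdivision
by the interior point `c`, and `T` is obtained from `Δ` by successive single stellar subdivisions
of `k` distinct facets `F_{j 0}, …, F_{j (k-1)}` of `Δ` by the interior points `r 0, …, r (k-1)`
(`U i` is the triangulation after the first `i` of these). -/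
theorem mainTheorem3 (n : ℕ) (σ : Affine.Simplex ℝ (EuclideanSpace ℝ (Fin n)) n)
    (c : EuclideanSpace ℝ (Fin n))
    (Δ : Geometry.SimplicialComplex ℝ (EuclideanSpace ℝ (Fin n)))
    (hΔ : IsStellarSubdivision (simplexComplex σ) (Finset.univ.image σ.points) c Δ)
    (k : ℕ) (j : Fin k ↪ Fin (n + 1)) (r : Fin k → EuclideanSpace ℝ (Fin n))
    (U : Fin (k + 1) → Geometry.SimplicialComplex ℝ (EuclideanSpace ℝ (Fin n)))
    (hU₀ : U 0 = Δ)
    (hU : ∀ i : Fin k,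
      IsStellarSubdivision (U i.castSucc) (stellarFacet σ c (j i)) (r i) (U i.succ))
    (T : Geometry.SimplicialComplex ℝ (EuclideanSpace ℝ (Fin n)))
    (hT : T = U (Fin.last k)) (hDel : IsDelaunayTriangulation T) :
    k < 3 := by
  by_contra! hk
  have hkn : k ≤ n + 1 := by simpa using Fintype.card_le_of_embedding j
  have : Nontrivial (Fin (n + 1)) := Fin.nontrivial_iff_two_le.2 (by omega)
  obtain ⟨w, hwpos, hwsum, hwcomb⟩ :=
    exists_pos_weights_of_mem_interior_convexHull ((simplexComplex σ).indep hΔ.1) hΔ.2.2.1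
  rw [Finset.sum_image σ.independent.injective.injOn] at hwsum hwcomb
  obtain ⟨lam, hlam⟩ : ∃ lam : Fin (n + 1) → ℝ, ∀ i, lam i = w (σ.points i) := ⟨_, fun _ => rfl⟩
  simp only [← hlam] at hwsum hwcomb
  have hlampos : ∀ i, 0 < lam i := fun i => by
    rw [hlam]
    exact hwpos _ (by simp)
  have hc : ∀ m, c ≠ σ.points m := σ.independent.ne_of_pos_weights hlampos hwsum hwcomb
  choose a₀ a ha using fun i => exists_isFacetCombination hc ((U i.castSucc).indep (hU i).1)
    (hU i).2.2.1
  have hrv : ∀ i m, r i ≠ σ.points m := fun i =>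
    (ha i).ne_point σ.independent hlampos hwsum hwcomb
  have hrc : ∀ i, c ≠ r i := fun i => (ha i).ne_apex σ.independent hlampos hwsum hwcomb
  have hrF : ∀ i m, r i ∉ stellarFacet σ c m := by
    intro i m h
    rcases mem_stellarFacet.1 h with h | ⟨l, _, h⟩
    · exact hrc i h.symm
    · exact hrv i l h.symm
  have hfaces : ∀ i l, l ≠ j i → stackedFacet σ c (j i) l (r i) ∈ T.faces := fun i l hl =>
    hT ▸ stackedFacet_mem_last hU hrF i hl
  have hrT : ∀ i, r i ∈ T.vertices := fun i => by
    obtain ⟨l, hl⟩ := exists_ne (j i)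
    exact Geometry.SimplicialComplex.mem_vertices_of_mem_face (hfaces i l hl)
      self_mem_stackedFacet
  let t : Fin 3 → Fin k := Fin.castLE hk
  have ht : Function.Injective t := Fin.castLE_injective hk
  -- Among three distinct indices at least two differ from `m`; the simplex at one of them omitting
  -- the vertex of the other contains `σ.points m`.
  have hvT : ∀ m, σ.points m ∈ T.vertices := by
    intro m
    obtain ⟨i, hi⟩ : ∃ i, j i ≠ m := by
      by_contra! h
      exact absurd (ht (j.injective ((h (t 0)).trans (h (t 1)).symm))) (by decide)
    obtain ⟨i', hi', hi''⟩ : ∃ i', j i' ≠ m ∧ j i' ≠ j i := by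
      by_contra! h
      have key : ∀ x y : Fin 3, j (t x) ≠ m → j (t y) ≠ m → x = y := fun x y hx hy =>
        ht (j.injective ((h _ hx).trans (h _ hy).symm))
      have key' : ∀ x y : Fin 3, j (t x) = m → j (t y) = m → x = y := fun x y hx hy =>
        ht (j.injective (hx.trans hy.symm))
      have e01 := key 0 1
      have e02 := key 0 2
      have e12 := key 1 2
      have f01 := key' 0 1
      have f02 := key' 0 2
      have f12 := key' 1 2
      simp only [show (0 : Fin 3) ≠ 1 by decide, show (0 : Fin 3) ≠ 2 by decide,
        show (1 : Fin 3) ≠ 2 by decide] at e01 e02 e12 f01 f02 f12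
      tauto
    exact Geometry.SimplicialComplex.mem_vertices_of_mem_face (hfaces i (j i') hi'')
      (point_mem_stackedFacet hi.symm hi'.symm)
  -- the sphere through `c`, `r i` and all vertices of `σ` but two
  have hpower : ∀ i l, l ≠ j i → ∃ (z : EuclideanSpace ℝ (Fin n)) (R : ℝ),
      a i l * (‖σ.points l - z‖ ^ 2 - R) = facetMoment σ.points c (r i) (a₀ i) (a i) ∧
      lam (j i) * (‖σ.points (j i) - z‖ ^ 2 - R) + lam l * (‖σ.points l - z‖ ^ 2 - R) =
        ∑ m, lam m * ‖σ.points m - c‖ ^ 2 ∧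
      ‖c - z‖ ^ 2 - R = 0 ∧ (∀ m, m ≠ j i → m ≠ l → ‖σ.points m - z‖ ^ 2 - R = 0) ∧
      0 < ‖σ.points (j i) - z‖ ^ 2 - R ∧ ∀ i', 0 ≤ ‖r i' - z‖ ^ 2 - R := by
    intro i l hl
    obtain ⟨z, R, h0, hpos⟩ := (hDel.delaunay _ (hfaces i l hl)
      (card_stackedFacet (hU i).2.1 hl (hrF i _))).exists_power ⟨_, self_mem_stackedFacet⟩
    have hcz := h0 c (apex_mem_stackedFacet hc)
    have hvz : ∀ m, m ≠ j i → m ≠ l → ‖σ.points m - z‖ ^ 2 - R = 0 := fun m h1 h2 =>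
      h0 _ (point_mem_stackedFacet h1 h2)
    refine ⟨z, R, (ha i).power_vertex hcz (h0 _ self_mem_stackedFacet) hvz,
      power_pair_eq hwsum hwcomb hl.symm hcz hvz, hcz, hvz,
      hpos _ (hvT _) (point_notMem_stackedFacet hc (hrv i)), fun i' => ?_⟩
    by_cases hi' : r i' ∈ stackedFacet σ c (j i) l (r i)
    · exact (h0 _ hi').ge
    · exact (hpos _ (hrT i') hi').le
  refine not_three_facetCombinations hlampos hwsum hwcomb (fun i => j (t i))
    (j.injective.comp ht) (fun i => r (t i)) (fun i => hrc (t i)) (fun i => a₀ (t i))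
    (fun i => a (t i)) (fun i => ha (t i)) (fun i l hl => ?_) (fun i i' hii => ?_)
  · obtain ⟨z, R, h1, h2, -, -, h3, -⟩ := hpower (t i) l hl
    have h4 := (ha (t i)).pos l hl
    have h5 : lam l * (‖σ.points l - z‖ ^ 2 - R) ≤ ∑ m, lam m * ‖σ.points m - c‖ ^ 2 := by
      linarith [mul_pos (hlampos (j (t i))) h3]
    rw [← h1]
    linarith [mul_le_mul_of_nonneg_right h5 h4.le]
  · have hne : j (t i') ≠ j (t i) := fun h => hii (ht (j.injective h)).symm
    obtain ⟨z, R, h1, h2, hcz, hvz, -, h3⟩ := hpower (t i) (j (t i')) hne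
    have h4 := (ha (t i)).pos _ hne
    have h5 := (ha (t i')).pos _ hne.symm
    -- For the sphere belonging to `r (t i)`, only `v (j (t i))` contributes to the mean for `r (t
    -- i')`: its weight at `v (j (t i'))` is zero and its other vertices lie on the sphere.
    have h6 := (ha (t i')).power_eq z R
    rw [hcz, mul_zero, zero_add, Finset.sum_eq_single (j (t i))] at h6
    · have h7 : facetMoment σ.points c (r (t i')) (a₀ (t i')) (a (t i')) ≤
          a (t i') (j (t i)) * (‖σ.points (j (t i)) - z‖ ^ 2 - R) := by
        linarith [h3 (t i')]
      have h8 : lam (j (t i')) * facetMoment σ.points c (r (t i)) (a₀ (t i)) (a (t i)) /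
          a (t i) (j (t i')) = lam (j (t i')) * (‖σ.points (j (t i')) - z‖ ^ 2 - R) := by
        rw [← h1]
        field_simp
      have h9 : lam (j (t i)) * facetMoment σ.points c (r (t i')) (a₀ (t i')) (a (t i')) /
          a (t i') (j (t i)) ≤ lam (j (t i)) * (‖σ.points (j (t i)) - z‖ ^ 2 - R) := by
        rw [div_le_iff₀ h5]
        linarith [mul_le_mul_of_nonneg_left h7 (hlampos (j (t i))).le]
      rw [h8]
      linarith
    · intro m _ hm
      by_cases hm' : m = j (t i')
      · rw [hm', (ha (t i')).zero, zero_mul]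
      · rw [hvz m hm hm', mul_zero]
    · simp
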